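/- Let $G$ be a connected Lie group with unit $e$, let $H\subseteq G$ be a compact connected subgroup, and let $\pi:G\to G/H$ be the projection, where $G/H$ carries its manifold structure as a homogeneous space (the one for which $\pi$ is a smooth submersion). Put $p_0=\pi(e)=H$. Let $\mathcal G$ be a $G$-invariant Riemannian metric on $G/H$, let $d_{\mathcal G}$ be its Riemannian distance, and let $\|v\|_{\tilde{\mathcal G}}=\sqrt{\mathcal G(\pi_*v,\pi_*v)}$ be the induced seminorm on tangent vectors of $G$. Suppose that the Lie group exponential map $\exp_G$ maps some neighbourhood $V\subseteq T_eG$ of $0$ bijectively onto $G$, let $\log_G:G\to V$ be the inverse of this bijection, and suppose that $\log_G$ maps compact sets to relatively compact sets (for example, $\exp_G:V\to G$ may be a diffeomorphism; for $G=SE(2)$ one may take $V=\{c : c^3\in[-\pi,\pi)\}$, where $c^3$ is the angular coordinate). Define $$\rho_{\mathcal G}(p)=\inf_{g\in p}\|\log_G g\|_{\tilde{\mathcal G}}\qquad(p\in G/H),$$ where the infimum is over all elements $g$ of the coset $p$. Then $$d_{\mathcal G}(p_0,p)\le\rho_{\mathcal G}(p)\qquad\text{for all }p\in G/H,$$ and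 for every compact neighbourhood $K$ of $p_0$ that is disjoint from the cut locus of $p_0$ there is a constant $C_{\mathrm{metr}}\ge 1$ such that $$d_{\mathcal G}(p_0,p)\le\rho_{\mathcal G}(p)\le C_{\mathrm{metr}}\,d_{\mathcal G}(p_0,p)\qquad\text{for all }p\in K.$$ -/

import Mathlib

open Set Topology Manifold Bundle
open scoped Manifold ContDiff ENNReal NNReal

/-- The exponential map `exp_G : T_e G → G` of a Lie group: `exp_G v` is the value at time `1` of
the integral curve, starting at the unit, of the left-invariant vector field generated by `v`. (For
a Lie group this curve exists on all of `ℝ` and is unique.) -/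
noncomputable def lieExp {E : Type*} [NormedAddCommGroup E] [NormedSpace ℝ E]
    {G : Type*} [TopologicalSpace G] [ChartedSpace E G] [Group G]
    (v : GroupLieAlgebra 𝓘(ℝ, E) G) : G :=
  Classical.epsilon fun g : G ↦ ∃ γ : ℝ → G,
    γ 0 = 1 ∧ IsMIntegralCurve (I := 𝓘(ℝ, E)) γ (fun x : G ↦ mulInvariantVectorField v x) ∧ γ 1 = g

/-- The logarithm `log_G : G → V`, the inverse of the restriction of `exp_G` to `V ⊆ T_e G`
(meaningful when `exp_G` maps `V` bijectively onto `G`). -/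
noncomputable def lieLog {E : Type*} [NormedAddCommGroup E] [NormedSpace ℝ E]
    {G : Type*} [TopologicalSpace G] [ChartedSpace E G] [Group G]
    (V : Set (GroupLieAlgebra 𝓘(ℝ, E) G)) (g : G) : GroupLieAlgebra 𝓘(ℝ, E) G :=
  Function.invFunOn lieExp V g

/-- `V ⊆ T_e G` is an admissible range for the logarithm: a neighbourhood of `0` that `exp_G` maps
bijectively onto `G`, such that the inverse `log_G` maps compact sets to relatively compact sets.
Nothing is asked about the continuity of `log_G` far from the unit. When `exp_G` restricts to a
homeomorphism or diffeomorphism from an open `V` containing `0` (for instance `V = T_e G`) onto `G`,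
all three conditions hold; they also hold for ranges such as
`V = {c | c³ ∈ [-π, π)}` for `G = SE(2)`. -/
structure IsLogRange {E : Type*} [NormedAddCommGroup E] [NormedSpace ℝ E]
    {G : Type*} [TopologicalSpace G] [ChartedSpace E G] [Group G]
    (V : Set (GroupLieAlgebra 𝓘(ℝ, E) G)) : Prop where
  mem_nhds : V ∈ 𝓝 (0 : GroupLieAlgebra 𝓘(ℝ, E) G)
  bijOn : BijOn lieExp V (univ : Set G)
  bounded : ∀ K : Set G, IsCompact K →
    ∃ B : Set (GroupLieAlgebra 𝓘(ℝ, E) G), IsCompact B ∧ lieLog V '' K ⊆ B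

/-- A metric tensor field on `G ⧸ H` is `G`-invariant if all the differentials
`(L_g)_* : T_p (G ⧸ H) → T_{g p} (G ⧸ H)` preserve it. -/
def IsInvariantMetric {F : Type*} [NormedAddCommGroup F] [NormedSpace ℝ F]
    {G : Type*} [TopologicalSpace G] [Group G] (H : Subgroup G) [ChartedSpace F (G ⧸ H)]
    [RiemannianBundle (fun p : G ⧸ H ↦ TangentSpace 𝓘(ℝ, F) p)] : Prop :=
  ∀ (g : G) (p : G ⧸ H) (v w : TangentSpace 𝓘(ℝ, F) p),
    inner ℝ (mfderiv 𝓘(ℝ, F) 𝓘(ℝ, F) (fun q : G ⧸ H ↦ g • q) p v)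
      (mfderiv 𝓘(ℝ, F) 𝓘(ℝ, F) (fun q : G ⧸ H ↦ g • q) p w) = inner ℝ v w

/-- The seminorm on `T_g G` obtained by pulling the metric tensor field of `G ⧸ H` back along the
projection `π : G → G ⧸ H`, that is, `‖v‖ = ‖π_* v‖`. -/
noncomputable def pullbackSeminorm {E : Type*} [NormedAddCommGroup E] [NormedSpace ℝ E]
    {F : Type*} [NormedAddCommGroup F] [NormedSpace ℝ F]
    {G : Type*} [TopologicalSpace G] [ChartedSpace E G] [Group G]
    (H : Subgroup G) [ChartedSpace F (G ⧸ H)]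
    [RiemannianBundle (fun p : G ⧸ H ↦ TangentSpace 𝓘(ℝ, F) p)]
    (g : G) (v : TangentSpace 𝓘(ℝ, E) g) : ℝ≥0∞ :=
  ‖mfderiv 𝓘(ℝ, E) 𝓘(ℝ, F) (fun x : G ↦ (x : G ⧸ H)) g v‖ₑ

/-- The logarithmic metric estimate `ρ(p) = inf_{g ∈ p} ‖log_G g‖`, the infimum being over all the
elements `g` of the coset `p`. -/
noncomputable def logMetricEstimate {E : Type*} [NormedAddCommGroup E] [NormedSpace ℝ E]
    {F : Type*} [NormedAddCommGroup F] [NormedSpace ℝ F]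
    {G : Type*} [TopologicalSpace G] [ChartedSpace E G] [Group G]
    (H : Subgroup G) [ChartedSpace F (G ⧸ H)]
    [RiemannianBundle (fun p : G ⧸ H ↦ TangentSpace 𝓘(ℝ, F) p)]
    (V : Set (GroupLieAlgebra 𝓘(ℝ, E) G)) (p : G ⧸ H) : ℝ≥0∞ :=
  ⨅ (g : G) (_ : (g : G ⧸ H) = p), pullbackSeminorm (F := F) H (1 : G) (lieLog V g)

/-- A unit-speed geodesic ray `γ : [0, ∞) → M` (values at negative times are irrelevant): a curve
that locally realizes the Riemannian distance. -/
def IsGeodesicRay {F : Type*} [NormedAddCommGroup F] [NormedSpace ℝ F]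
    {M : Type*} [TopologicalSpace M] [ChartedSpace F M]
    [RiemannianBundle (fun p : M ↦ TangentSpace 𝓘(ℝ, F) p)] (γ : ℝ → M) : Prop :=
  ∀ t : ℝ, 0 ≤ t → ∃ ε > 0, ∀ s s' : ℝ, 0 ≤ s → 0 ≤ s' → |s - t| < ε → |s' - t| < ε →
    riemannianEDist 𝓘(ℝ, F) (γ s) (γ s') = ENNReal.ofReal |s - s'|

/-- The cut locus of `p` in a (complete) Riemannian manifold: the points `γ t₀`, with `t₀ > 0`, such
that the unit-speed geodesic ray `γ` from `p` is minimizing up to time `t₀`, and not beyond it. -/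
def cutLocus {F : Type*} [NormedAddCommGroup F] [NormedSpace ℝ F]
    {M : Type*} [TopologicalSpace M] [ChartedSpace F M]
    [RiemannianBundle (fun p : M ↦ TangentSpace 𝓘(ℝ, F) p)] (p : M) : Set M :=
  {q | ∃ (γ : ℝ → M) (t₀ : ℝ), IsGeodesicRay (F := F) γ ∧ γ 0 = p ∧ 0 < t₀ ∧ γ t₀ = q ∧
    riemannianEDist 𝓘(ℝ, F) p (γ t₀) = ENNReal.ofReal t₀ ∧
    ∀ t : ℝ, t₀ < t → riemannianEDist 𝓘(ℝ, F) p (γ t) < ENNReal.ofReal t}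

/-! Lower bound: if `g` lies in the coset `p` and `v = log g`, the curve `t ↦ π (exp (t v))` joins
`p₀` to `p`. Its velocity is the image under `π` of a left-invariant field, so by invariance of the
metric its speed is constantly `‖π_* v‖`, and this is its length on `[0, 1]`. Taking the infimum
over `g` gives `d ≤ ρ` (`riemannianEDist_le_logMetricEstimate`).

Upper bound near `p₀`: the derivative of `exp` at `0` is the identity, so `π ∘ exp` has a surjective
strict derivative there. The inverse function theorem yields `v ∈ V` with `π (exp v) = p` and `‖v‖`
at most a multiple of the chart distance from `p₀` to `p` (`exists_lieExp_preimage_enorm_le`), which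
is at most a multiple of `d` (`exists_edist_extChartAt_le_riemannianEDist`). As `log (exp v) = v`,
this bounds `ρ p`.

Upper bound away from `p₀`: `ρ` is bounded on compact sets because `log` is
(`exists_logMetricEstimate_le_of_isCompact`), while `d` is bounded below.

The derivative of `exp` comes from the equation `x' = f(x) v` of left-invariant fields in a chart,
with `f` the identity at the unit: its time-one map differs from a translate of the identity by a
quadratically small error. -/

/-! ### Equations linear in a parameter. -/

/-- Solutions of `x' = f(x) v` with `x(0) = x₀`, for small `v`. -/
theorem exists_linear_ode_solution {E : Type*} [NormedAddCommGroup E] [NormedSpace ℝ E]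
    [CompleteSpace E] {f : E → E →L[ℝ] E} {x₀ : E} {a M : ℝ} {K : ℝ≥0}
    (hM : 0 ≤ M) (hf : LipschitzOnWith K f (Metric.closedBall x₀ a))
    (hfM : ∀ x ∈ Metric.closedBall x₀ a, ‖f x‖ ≤ M) {v : E} (hv : 2 * M * ‖v‖ ≤ a) :
    ∃ α : ℝ → E, α 0 = x₀ ∧ (∀ t ∈ Ioo (-2 : ℝ) 2, HasDerivAt α (f (α t) v) t) ∧
      ∀ t ∈ Icc (-2 : ℝ) 2, ‖α t - x₀‖ ≤ 2 * M * ‖v‖ := by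
  have hsub : Metric.closedBall x₀ (2 * M * ‖v‖) ⊆ Metric.closedBall x₀ a :=
    Metric.closedBall_subset_closedBall hv
  -- Speed at most `M * ‖v‖` for time at most `2` fixes this radius. Using it instead of `a` makes
  -- the displacement bound part of the Picard-Lindelöf output.
  let a' : ℝ≥0 := ⟨2 * M * ‖v‖, by positivity⟩
  let L : ℝ≥0 := ⟨M * ‖v‖, by positivity⟩
  let t₀ : Icc (-2 : ℝ) 2 := ⟨0, by norm_num⟩
  have hpl : IsPicardLindelof (fun _ x ↦ f x v) t₀ x₀ a' 0 L (K * ‖v‖₊) := by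
    refine IsPicardLindelof.of_time_independent (f := fun x ↦ f x v) (fun x hx ↦ ?_) ?_ ?_
    · exact ((f x).le_opNorm v).trans
        (mul_le_mul_of_nonneg_right (hfM x (hsub hx)) (norm_nonneg v))
    · refine LipschitzOnWith.of_dist_le_mul fun x hx y hy ↦ ?_
      rw [dist_eq_norm, ← sub_apply]
      refine ((f x - f y).le_opNorm v).trans ?_
      have := hf.dist_le_mul x (hsub hx) y (hsub hy)
      rw [dist_eq_norm] at this
      push_cast
      nlinarith [norm_nonneg v]
    · change M * ‖v‖ * max (2 - 0) (0 - -2) ≤ 2 * M * ‖v‖ - 0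
      norm_num
      linarith
  obtain ⟨α, hα⟩ := ODE.FunSpace.exists_isFixedPt_next hpl (Metric.mem_closedBall_self le_rfl)
  refine ⟨α.compProj, ?_, fun t ht ↦ ?_, fun t ht ↦ ?_⟩
  · exact (ODE.FunSpace.compProj_val (t := t₀)).trans (by rw [← hα, ODE.FunSpace.next_apply₀])
  · refine HasDerivWithinAt.hasDerivAt (s := Icc (-2 : ℝ) 2) ?_ (Icc_mem_nhds ht.1 ht.2)
    refine (ODE.hasDerivWithinAt_picard_Icc t₀.2 hpl.continuousOn_uncurry
      α.continuous_compProj.continuousOn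
      (fun _ ht' ↦ α.compProj_mem_closedBall hpl.mul_max_le) x₀ (Ioo_subset_Icc_self ht)).congr_of_mem
      (fun t' ht' ↦ ?_) (Ioo_subset_Icc_self ht)
    nth_rw 1 [← hα]
    rw [ODE.FunSpace.compProj_of_mem ht', ODE.FunSpace.next_apply]
  · have := α.compProj_mem_closedBall (t := t) hpl.mul_max_le
    rwa [mem_closedBall_iff_norm] at this

/-- The dependence on the parameter of the time-one value of solutions of `x' = f(x) v`. -/
theorem norm_linear_ode_sub_sub_le {E : Type*} [NormedAddCommGroup E] [NormedSpace ℝ E]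
    {f : E → E →L[ℝ] E} {x₀ : E} {s : Set E} {M : ℝ} {K : ℝ≥0} (hx₀ : x₀ ∈ s)
    (hf₀ : f x₀ = ContinuousLinearMap.id ℝ E) (hM : 0 ≤ M) (hf : LipschitzOnWith K f s)
    (hfM : ∀ x ∈ s, ‖f x‖ ≤ M) {v w : E} (hw : K * ‖w‖ ≤ 1 / 2) {x y : ℝ → E}
    (hx0 : x 0 = x₀) (hy0 : y 0 = x₀)
    (hx : ∀ t ∈ Icc (0 : ℝ) 1, HasDerivAt x (f (x t) v) t)
    (hy : ∀ t ∈ Icc (0 : ℝ) 1, HasDerivAt y (f (y t) w) t)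
    (hxs : ∀ t ∈ Icc (0 : ℝ) 1, x t ∈ s ∧ ‖x t - x₀‖ ≤ 2 * M * ‖v‖)
    (hys : ∀ t ∈ Icc (0 : ℝ) 1, y t ∈ s) :
    ‖x 1 - y 1 - (v - w)‖ ≤ 2 * K * M * (‖v‖ + ‖w‖) * ‖v - w‖ := by
  have hD : ∀ t ∈ Icc (0 : ℝ) 1, HasDerivAt (fun t ↦ x t - y t) (f (x t) v - f (y t) w) t :=
    fun t ht ↦ (hx t ht).sub (hy t ht)
  -- The maximal gap `S` is bounded by `M * ‖v - w‖ + K * S * ‖w‖`; since `K * ‖w‖ ≤ 1 / 2` the last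
  -- term is absorbed, which replaces Grönwall.
  obtain ⟨τ, hτ, hmax⟩ := (isCompact_Icc (a := (0 : ℝ)) (b := 1)).exists_isMaxOn
    (nonempty_Icc.2 zero_le_one)
    (f := fun t ↦ ‖x t - y t‖) fun t ht ↦ (hD t ht).continuousAt.norm.continuousWithinAt
  set S := ‖x τ - y τ‖ with hS
  have hS0 : 0 ≤ S := norm_nonneg _
  have hle : ∀ t ∈ Icc (0 : ℝ) 1, ‖x t - y t‖ ≤ S := fun t ht ↦ hmax ht
  have hsplit : ∀ t, f (x t) v - f (y t) w = f (x t) (v - w) + (f (x t) - f (y t)) w := by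
    intro t
    simp
  have hlip : ∀ t ∈ Icc (0 : ℝ) 1, ‖(f (x t) - f (y t)) w‖ ≤ K * S * ‖w‖ := by
    intro t ht
    refine ((f (x t) - f (y t)).le_opNorm w).trans ?_
    gcongr
    have := hf.dist_le_mul _ (hxs t ht).1 _ (hys t ht)
    rw [dist_eq_norm, dist_eq_norm] at this
    exact this.trans (by gcongr; exact hle t ht)
  have hSle : S ≤ M * ‖v - w‖ + K * S * ‖w‖ := by
    have h := norm_image_sub_le_of_norm_deriv_le_segment' (a := 0) (b := 1)
      (C := M * ‖v - w‖ + K * S * ‖w‖) (fun t ht ↦ (hD t ht).hasDerivWithinAt)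
      (fun t ht ↦ ?_) τ hτ
    · rw [hx0, hy0, sub_self, sub_zero] at h
      refine h.trans (mul_le_of_le_one_right (by positivity) (by linarith [hτ.2]))
    · have ht' := Ico_subset_Icc_self ht
      rw [hsplit]
      refine (norm_add_le _ _).trans (add_le_add ?_ (hlip t ht'))
      exact ((f (x t)).le_opNorm _).trans (by gcongr; exact hfM _ (hxs t ht').1)
  have hS2 : S ≤ 2 * M * ‖v - w‖ := by nlinarith
  -- After subtracting the linear motion, `f x₀ = id` leaves only second-order terms in the
  -- derivative.
  have hE : ∀ t ∈ Icc (0 : ℝ) 1, HasDerivWithinAt (fun t ↦ x t - y t - t • (v - w))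
      (f (x t) v - f (y t) w - (1 : ℝ) • (v - w)) (Icc 0 1) t := fun t ht ↦
    ((hD t ht).sub ((hasDerivAt_id t).smul_const (v - w))).hasDerivWithinAt
  have h := norm_image_sub_le_of_norm_deriv_le_segment' (a := 0) (b := 1)
      (C := 2 * K * M * (‖v‖ + ‖w‖) * ‖v - w‖) hE (fun t ht ↦ ?_) 1 (by simp)
  · simpa [hx0, hy0] using h
  · have ht' := Ico_subset_Icc_self ht
    have heq : f (x t) v - f (y t) w - (1 : ℝ) • (v - w) =
        (f (x t) - f x₀) (v - w) + (f (x t) - f (y t)) w := by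
      rw [hsplit, hf₀]
      simp only [one_smul, sub_apply, ContinuousLinearMap.id_apply]
      abel
    rw [heq]
    have h1 : ‖(f (x t) - f x₀) (v - w)‖ ≤ K * (2 * M * ‖v‖) * ‖v - w‖ := by
      refine ((f (x t) - f x₀).le_opNorm _).trans ?_
      gcongr
      have := hf.dist_le_mul _ (hxs t ht').1 _ hx₀
      rw [dist_eq_norm, dist_eq_norm] at this
      exact this.trans (by gcongr; exact (hxs t ht').2)
    have h2 : K * S * ‖w‖ ≤ K * (2 * M * ‖v - w‖) * ‖w‖ := by gcongr
    calc _ ≤ K * (2 * M * ‖v‖) * ‖v - w‖ + K * (2 * M * ‖v - w‖) * ‖w‖ :=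
          (norm_add_le _ _).trans (add_le_add h1 ((hlip t ht').trans h2))
      _ = _ := by ring

/-- The time-one map of `x' = f(x) v` is strictly differentiable in the parameter `v` at `0`. -/
theorem exists_linear_ode_flow {E : Type*} [NormedAddCommGroup E] [NormedSpace ℝ E]
    [CompleteSpace E] {f : E → E →L[ℝ] E} {x₀ : E} (hf : ContDiffAt ℝ 1 f x₀)
    (hf₀ : f x₀ = ContinuousLinearMap.id ℝ E) {s : Set E} (hs : s ∈ 𝓝 x₀) :
    ∃ α : E → ℝ → E, HasStrictFDerivAt (fun v ↦ α v 1) (ContinuousLinearMap.id ℝ E) 0 ∧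
      α 0 1 = x₀ ∧
      ∀ᶠ v in 𝓝 (0 : E), α v 0 = x₀ ∧
        ∀ t ∈ Ioo (-2 : ℝ) 2, α v t ∈ s ∧ HasDerivAt (α v) (f (α v t) v) t := by
  obtain ⟨K, u, hu, hlip⟩ := hf.exists_lipschitzOnWith
  have hbd : ∀ᶠ x in 𝓝 x₀, ‖f x‖ < ‖f x₀‖ + 1 :=
    hf.continuousAt.norm.eventually_lt continuousAt_const (by simp)
  obtain ⟨a, ha, hball⟩ := Metric.nhds_basis_closedBall.mem_iff.1
    (Filter.inter_mem (Filter.inter_mem hu hs) hbd)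
  set M := ‖f x₀‖ + 1 with hMdef
  have hM : 0 < M := by positivity
  have hlip' : LipschitzOnWith K f (Metric.closedBall x₀ a) := hlip.mono fun x hx ↦ (hball hx).1.1
  have hfM : ∀ x ∈ Metric.closedBall x₀ a, ‖f x‖ ≤ M := fun x hx ↦ (le_of_lt (hball hx).2)
  -- Smallness of `v` is a premise inside the existential, so that `choose` gives a family defined
  -- for all `v`.
  have hex : ∀ v : E, ∃ α : ℝ → E, 2 * M * ‖v‖ ≤ a → α 0 = x₀ ∧
      (∀ t ∈ Ioo (-2 : ℝ) 2, HasDerivAt α (f (α t) v) t) ∧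
      ∀ t ∈ Icc (-2 : ℝ) 2, ‖α t - x₀‖ ≤ 2 * M * ‖v‖ := by
    intro v
    by_cases hv : 2 * M * ‖v‖ ≤ a
    · obtain ⟨α, h⟩ := exists_linear_ode_solution hM.le hlip' hfM hv
      exact ⟨α, fun _ ↦ h⟩
    · exact ⟨fun _ ↦ 0, fun h ↦ absurd h hv⟩
  choose α hα using hex
  have hsmall : ∀ᶠ v in 𝓝 (0 : E), 2 * M * ‖v‖ ≤ a ∧ K * ‖v‖ ≤ 1 / 2 := by
    have h1 : Filter.Tendsto (fun v : E ↦ 2 * M * ‖v‖) (𝓝 0) (𝓝 0) := by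
      have : Continuous fun v : E ↦ 2 * M * ‖v‖ := by fun_prop
      simpa using this.tendsto 0
    have h2 : Filter.Tendsto (fun v : E ↦ K * ‖v‖) (𝓝 0) (𝓝 0) := by
      have : Continuous fun v : E ↦ K * ‖v‖ := by fun_prop
      simpa using this.tendsto 0
    exact (h1.eventually_le_const ha).and (h2.eventually_le_const (by norm_num))
  have hIcc : Icc (0 : ℝ) 1 ⊆ Ioo (-2) 2 := fun t ht ↦ ⟨by linarith [ht.1], by linarith [ht.2]⟩
  have hmem : ∀ v, 2 * M * ‖v‖ ≤ a → ∀ t ∈ Icc (-2 : ℝ) 2, α v t ∈ Metric.closedBall x₀ a :=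
    fun v hv t ht ↦ mem_closedBall_iff_norm.2 (((hα v hv).2.2 t ht).trans hv)
  refine ⟨α, ?_, ?_, ?_⟩
  · refine .of_isLittleO ?_
    have hO : (fun p : E × E ↦ α p.1 1 - α p.2 1 - ContinuousLinearMap.id ℝ E (p.1 - p.2))
        =O[𝓝 (0, 0)] fun p ↦ (‖p.1‖ + ‖p.2‖) * ‖p.1 - p.2‖ := by
      refine .of_bound (2 * K * M) ?_
      rw [nhds_prod_eq]
      filter_upwards [hsmall.prod_mk hsmall] with p hp
      have h := norm_linear_ode_sub_sub_le (Metric.mem_closedBall_self ha.le) hf₀ hM.le hlip' hfM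
        hp.2.2 (hα _ hp.1.1).1 (hα _ hp.2.1).1 (fun t ht ↦ (hα _ hp.1.1).2.1 t (hIcc ht))
        (fun t ht ↦ (hα _ hp.2.1).2.1 t (hIcc ht))
        (fun t ht ↦ ⟨hmem _ hp.1.1 t (Ioo_subset_Icc_self (hIcc ht)),
          (hα _ hp.1.1).2.2 t (Ioo_subset_Icc_self (hIcc ht))⟩)
        (fun t ht ↦ hmem _ hp.2.1 t (Ioo_subset_Icc_self (hIcc ht)))
      refine h.trans (le_of_eq ?_)
      rw [Real.norm_of_nonneg (by positivity)]
      ring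
    refine hO.trans_isLittleO ?_
    have h0 : (fun p : E × E ↦ ‖p.1‖ + ‖p.2‖) =o[𝓝 (0, 0)] fun _ ↦ (1 : ℝ) := by
      rw [Asymptotics.isLittleO_one_iff]
      have : Continuous fun p : E × E ↦ ‖p.1‖ + ‖p.2‖ := by fun_prop
      simpa using this.tendsto (0, 0)
    have := h0.mul_isBigO (Asymptotics.isBigO_refl (fun p : E × E ↦ ‖p.1 - p.2‖) (𝓝 (0, 0)))
    simpa using this
  · have h := (hα 0 (by simpa using ha.le)).2.2 1 (by norm_num)
    simpa [sub_eq_zero] using h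
  · filter_upwards [hsmall] with v hv
    exact ⟨(hα v hv.1).1, fun t ht ↦ ⟨(hball (hmem v hv.1 t (Ioo_subset_Icc_self ht))).1.2,
      (hα v hv.1).2.1 t ht⟩⟩

/-! ### The exponential map of a Lie group. -/

section LieGroupExp

variable {E : Type*} [NormedAddCommGroup E] [NormedSpace ℝ E]
  {G : Type*} [TopologicalSpace G] [ChartedSpace E G] [Group G] [LieGroup 𝓘(ℝ, E) ∞ G]

theorem contMDiff_mulInvariantVectorField_one (v : GroupLieAlgebra 𝓘(ℝ, E) G) :
    ContMDiff 𝓘(ℝ, E) 𝓘(ℝ, E).tangent 1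
      (fun g : G ↦ (⟨g, mulInvariantVectorField v g⟩ : TangentBundle 𝓘(ℝ, E) G)) := by
  have : LieGroup 𝓘(ℝ, E) (minSmoothness ℝ 3) G := by
    rw [minSmoothness_of_isRCLikeNormedField]
    exact LieGroup.of_le (n := ∞) (show ((3 : ℕ∞) : ℕ∞ω) ≤ (⊤ : ℕ∞) from WithTop.coe_le_coe.2 le_top)
  refine (contMDiff_mulInvariantVectorField v).of_le ?_
  rw [minSmoothness_of_isRCLikeNormedField]
  norm_num

theorem mdifferentiable_mul_left_infty (g : G) :
    MDifferentiable 𝓘(ℝ, E) 𝓘(ℝ, E) (fun x : G ↦ g * x) :=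
  (contMDiff_mul_left (I := 𝓘(ℝ, E)) (n := ∞) (a := g)).mdifferentiable (by simp)

/-- Left-invariant vector fields are invariant under left translations. -/
theorem mfderiv_mul_left_mulInvariantVectorField (v : GroupLieAlgebra 𝓘(ℝ, E) G) (g h : G) :
    mfderiv 𝓘(ℝ, E) 𝓘(ℝ, E) (fun x : G ↦ g * x) h (mulInvariantVectorField v h) =
      mulInvariantVectorField v (g * h) := by
  have hcomp : (fun x : G ↦ g * h * x) = (fun x ↦ g * x) ∘ fun x ↦ h * x := by
    ext x
    simp [mul_assoc]
  have h1 : mfderiv 𝓘(ℝ, E) 𝓘(ℝ, E) (fun x : G ↦ g * h * x) 1 v =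
      mfderiv 𝓘(ℝ, E) 𝓘(ℝ, E) (fun x : G ↦ g * x) (h * 1)
        (mfderiv 𝓘(ℝ, E) 𝓘(ℝ, E) (fun x : G ↦ h * x) 1 v) := by
    rw [hcomp, mfderiv_comp (I' := 𝓘(ℝ, E)) (1 : G) (mdifferentiable_mul_left_infty g _)
      (mdifferentiable_mul_left_infty h _)]
    rfl
  have h2 : (mfderiv 𝓘(ℝ, E) 𝓘(ℝ, E) (fun x : G ↦ g * x) (h * 1) : E →L[ℝ] E) =
      mfderiv 𝓘(ℝ, E) 𝓘(ℝ, E) (fun x : G ↦ g * x) h := by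
    rw [mul_one]
  exact (DFunLike.congr_fun h2 _).symm.trans h1.symm

/-- Left translates of integral curves of left-invariant vector fields are integral curves. -/
theorem IsMIntegralCurveOn.mul_left_mulInvariantVectorField {v : GroupLieAlgebra 𝓘(ℝ, E) G}
    {γ : ℝ → G} {s : Set ℝ}
    (hγ : IsMIntegralCurveOn (I := 𝓘(ℝ, E)) γ (fun x ↦ mulInvariantVectorField v x) s) (g : G) :
    IsMIntegralCurveOn (I := 𝓘(ℝ, E)) (fun t ↦ g * γ t)
      (fun x ↦ mulInvariantVectorField v x) s := by
  intro t ht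
  have h := ((mdifferentiable_mul_left_infty (E := E) g (γ t)).hasMFDerivAt).comp_hasMFDerivWithinAt
    t (hγ t ht)
  have heq : ((1 : ℝ →L[ℝ] ℝ).smulRight (mulInvariantVectorField v (g * γ t)) : ℝ →L[ℝ] E) =
      (mfderiv 𝓘(ℝ, E) 𝓘(ℝ, E) (fun x : G ↦ g * x) (γ t) : E →L[ℝ] E).comp
        ((1 : ℝ →L[ℝ] ℝ).smulRight (mulInvariantVectorField v (γ t) : E)) := by
    ext
    change (1 : ℝ) • (mulInvariantVectorField v (g * γ t) : E) =
      (mfderiv 𝓘(ℝ, E) 𝓘(ℝ, E) (fun x : G ↦ g * x) (γ t) : E →L[ℝ] E)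
        ((1 : ℝ) • (mulInvariantVectorField v (γ t) : E))
    rw [one_smul, one_smul]
    exact (mfderiv_mul_left_mulInvariantVectorField v g (γ t)).symm
  exact heq ▸ h

/-- Left-invariant vector fields are complete. -/
theorem exists_isMIntegralCurve_mulInvariantVectorField [CompleteSpace E] [T2Space G]
    (v : GroupLieAlgebra 𝓘(ℝ, E) G) :
    ∃ γ : ℝ → G, γ 0 = 1 ∧
      IsMIntegralCurve (I := 𝓘(ℝ, E)) γ (fun x : G ↦ mulInvariantVectorField v x) := by
  have : IsManifold 𝓘(ℝ, E) 1 G := IsManifold.of_le (n := ∞) (by exact_mod_cast le_top)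
  obtain ⟨γ, hγ0, hγ⟩ := exists_isMIntegralCurveAt_of_contMDiffAt_boundaryless (t₀ := 0)
    (contMDiff_mulInvariantVectorField_one v).contMDiffAt (x₀ := (1 : G))
  obtain ⟨ε, hε, hγ⟩ := isMIntegralCurveAt_iff'.1 hγ
  -- Left translation carries the local curve at the unit to every point with the same lifetime `ε`,
  -- and a uniform lifetime forces completeness.
  refine exists_isMIntegralCurve_of_isMIntegralCurveOn (contMDiff_mulInvariantVectorField_one v) hε
    (fun g ↦ ⟨fun t ↦ g * γ t, by simp [hγ0], ?_⟩) 1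
  rw [Real.ball_eq_Ioo] at hγ
  simpa using hγ.mul_left_mulInvariantVectorField g

/-- `exp_G v` is the value at time `1` of any integral curve of the left-invariant vector field of
`v` that starts at the unit. -/
theorem lieExp_eq_of_isMIntegralCurveOn [CompleteSpace E] [T2Space G]
    {v : GroupLieAlgebra 𝓘(ℝ, E) G} {γ : ℝ → G} (hγ0 : γ 0 = 1)
    (hγ : IsMIntegralCurveOn (I := 𝓘(ℝ, E)) γ (fun x ↦ mulInvariantVectorField v x)
      (Ioo (-2) 2)) :
    lieExp v = γ 1 := by
  have : IsManifold 𝓘(ℝ, E) 1 G := IsManifold.of_le (n := ∞) (by exact_mod_cast le_top)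
  obtain ⟨η, hη0, hη⟩ := exists_isMIntegralCurve_mulInvariantVectorField v
  -- The curve `η'` behind the choice in `lieExp` is arbitrary; uniqueness on `(-2, 2)` identifies
  -- it with `γ` up to time `1`.
  obtain ⟨η', hη'0, hη', hη'1⟩ := Classical.epsilon_spec
    (p := fun g : G ↦ ∃ γ : ℝ → G, γ 0 = 1 ∧
      IsMIntegralCurve (I := 𝓘(ℝ, E)) γ (fun x : G ↦ mulInvariantVectorField v x) ∧ γ 1 = g)
    ⟨η 1, η, hη0, hη, rfl⟩
  rw [lieExp, ← hη'1]
  exact isMIntegralCurveOn_Ioo_eqOn_of_contMDiff_boundaryless (t₀ := 0) (by norm_num)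
    (contMDiff_mulInvariantVectorField_one v) (hη'.isMIntegralCurveOn _) hγ (by rw [hη'0, hγ0])
    (by norm_num)

variable (E G) in
/-- The multiplication of `G` in the chart at the unit. -/
noncomputable def chartMul (x y : E) : E :=
  extChartAt 𝓘(ℝ, E) (1 : G)
    ((extChartAt 𝓘(ℝ, E) (1 : G)).symm x * (extChartAt 𝓘(ℝ, E) (1 : G)).symm y)

variable (E G) in
/-- The chart at the unit, applied to the unit. -/
noncomputable def chartOne : E := extChartAt 𝓘(ℝ, E) (1 : G) 1

variable (E G) in
/-- `chartFrame E G x v` is the left-invariant vector field of `v` in the chart at the unit. -/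
noncomputable def chartFrame (x : E) : E →L[ℝ] E :=
  fderiv ℝ (chartMul E G x) (chartOne E G)

omit [LieGroup 𝓘(ℝ, E) ∞ G] in
theorem extChartAt_one_symm_chartOne :
    (extChartAt 𝓘(ℝ, E) (1 : G)).symm (chartOne E G) = 1 :=
  extChartAt_to_inv (I := 𝓘(ℝ, E)) (1 : G)

omit [LieGroup 𝓘(ℝ, E) ∞ G] in
theorem chartOne_mem_target : chartOne E G ∈ (extChartAt 𝓘(ℝ, E) (1 : G)).target :=
  mem_extChartAt_target (I := 𝓘(ℝ, E)) (1 : G)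

omit [LieGroup 𝓘(ℝ, E) ∞ G] in
theorem chartMul_chartOne {x : E} (hx : x ∈ (extChartAt 𝓘(ℝ, E) (1 : G)).target) :
    chartMul E G x (chartOne E G) = x := by
  rw [chartMul, extChartAt_one_symm_chartOne, mul_one, PartialEquiv.right_inv _ hx]

theorem contDiffAt_chartMul {x : E} (hx : x ∈ (extChartAt 𝓘(ℝ, E) (1 : G)).target) :
    ContDiffAt ℝ ∞ (Function.uncurry (chartMul E G)) (x, chartOne E G) := by
  have hsymm : ∀ y ∈ (extChartAt 𝓘(ℝ, E) (1 : G)).target,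
      ContMDiffAt 𝓘(ℝ, E) 𝓘(ℝ, E) ∞ (extChartAt 𝓘(ℝ, E) (1 : G)).symm y := fun y hy ↦
    (contMDiffOn_extChartAt_symm (1 : G)).contMDiffAt
      ((isOpen_extChartAt_target (I := 𝓘(ℝ, E)) (1 : G)).mem_nhds hy)
  rw [← contMDiffAt_iff_contDiffAt]
  have h1 : ContMDiffAt 𝓘(ℝ, E × E) 𝓘(ℝ, E) ∞
      (fun p : E × E ↦ (extChartAt 𝓘(ℝ, E) (1 : G)).symm p.1) (x, chartOne E G) :=
    ContMDiffAt.comp (x, chartOne E G) (hsymm x hx)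
      (contMDiffAt_iff_contDiffAt.2 contDiffAt_fst)
  have h2 : ContMDiffAt 𝓘(ℝ, E × E) 𝓘(ℝ, E) ∞
      (fun p : E × E ↦ (extChartAt 𝓘(ℝ, E) (1 : G)).symm p.2) (x, chartOne E G) :=
    ContMDiffAt.comp (x, chartOne E G) (hsymm _ chartOne_mem_target)
      (contMDiffAt_iff_contDiffAt.2 contDiffAt_snd)
  refine ContMDiffAt.comp (x, chartOne E G) (I' := 𝓘(ℝ, E)) ?_ (h1.mul h2)
  refine contMDiffAt_extChartAt' ?_
  simp only [extChartAt_one_symm_chartOne, mul_one]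
  simpa [extChartAt_source] using (extChartAt 𝓘(ℝ, E) (1 : G)).map_target hx

-- Multiplication by the unit is the identity in the chart. This normalization is why `exp` has
-- identity derivative at `0`.
omit [LieGroup 𝓘(ℝ, E) ∞ G] in
theorem chartFrame_chartOne : chartFrame E G (chartOne E G) = ContinuousLinearMap.id ℝ E := by
  have h : chartMul E G (chartOne E G) =ᶠ[𝓝 (chartOne E G)] id := by
    filter_upwards [(isOpen_extChartAt_target (I := 𝓘(ℝ, E)) (1 : G)).mem_nhds
      chartOne_mem_target] with y hy
    rw [chartMul, extChartAt_one_symm_chartOne, one_mul, PartialEquiv.right_inv _ hy, id]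
  rw [chartFrame, h.fderiv_eq, fderiv_id]

theorem contDiffAt_chartFrame : ContDiffAt ℝ 1 (chartFrame E G) (chartOne E G) :=
  ContDiffAt.fderiv (n := ∞) (g := fun _ ↦ chartOne E G) (contDiffAt_chartMul chartOne_mem_target)
    contDiffAt_const (show ((2 : ℕ∞) : ℕ∞ω) ≤ (⊤ : ℕ∞) from WithTop.coe_le_coe.2 le_top)

/-- Near the unit, left translation by `φ.symm x` equals `φ.symm ∘ chartMul E G x ∘ φ`; the chain
rule applies, and the chart `φ` at the unit has identity derivative there. -/
theorem mulInvariantVectorField_eq_mfderiv_chartFrame (v : GroupLieAlgebra 𝓘(ℝ, E) G) {x : E}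
    (hx : x ∈ (extChartAt 𝓘(ℝ, E) (1 : G)).target) :
    mulInvariantVectorField v ((extChartAt 𝓘(ℝ, E) (1 : G)).symm x) =
      mfderiv 𝓘(ℝ, E) 𝓘(ℝ, E) (extChartAt 𝓘(ℝ, E) (1 : G)).symm x (chartFrame E G x v) := by
  have : IsManifold 𝓘(ℝ, E) 1 G := IsManifold.of_le (n := ∞) (by exact_mod_cast le_top)
  set φ := extChartAt 𝓘(ℝ, E) (1 : G) with hφ
  set g := φ.symm x with hg
  have hm : DifferentiableAt ℝ (chartMul E G x) (chartOne E G) := by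
    have h1 := (contDiffAt_chartMul (G := G) hx).differentiableAt (by simp)
    exact h1.comp (chartOne E G) (f := fun y ↦ (x, y)) (by fun_prop)
  have hφ1 : HasMFDerivAt 𝓘(ℝ, E) 𝓘(ℝ, E) φ 1 (ContinuousLinearMap.id ℝ E) := by
    have h := (mdifferentiableAt_extChartAt (I := 𝓘(ℝ, E))
      (mem_chart_source E (1 : G))).hasMFDerivAt
    rwa [mfderiv_extChartAt_self] at h
  have hsymm : HasMFDerivAt 𝓘(ℝ, E) 𝓘(ℝ, E) φ.symm x
      (mfderiv 𝓘(ℝ, E) 𝓘(ℝ, E) φ.symm x) :=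
    (((contMDiffOn_extChartAt_symm (n := 1) (1 : G)).contMDiffAt
      ((isOpen_extChartAt_target (I := 𝓘(ℝ, E)) (1 : G)).mem_nhds hx)).mdifferentiableAt
        one_ne_zero).hasMFDerivAt
  have hcomp1 : HasMFDerivAt 𝓘(ℝ, E) 𝓘(ℝ, E) (chartMul E G x ∘ φ) 1
      ((chartFrame E G x).comp (ContinuousLinearMap.id ℝ E)) :=
    HasMFDerivAt.comp (1 : G) (I' := 𝓘(ℝ, E)) hm.hasFDerivAt.hasMFDerivAt hφ1
  have hval : (chartMul E G x ∘ φ) 1 = x := chartMul_chartOne hx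
  have hcomp2 : HasMFDerivAt 𝓘(ℝ, E) 𝓘(ℝ, E) (φ.symm ∘ (chartMul E G x ∘ φ)) 1
      ((mfderiv 𝓘(ℝ, E) 𝓘(ℝ, E) φ.symm x).comp
        ((chartFrame E G x).comp (ContinuousLinearMap.id ℝ E))) :=
    HasMFDerivAt.comp (1 : G) (I' := 𝓘(ℝ, E)) (by rw [hval]; exact hsymm) hcomp1
  have heq : (fun y : G ↦ g * y) =ᶠ[𝓝 1] φ.symm ∘ (chartMul E G x ∘ φ) := by
    have hcont : ContinuousAt (fun y : G ↦ g * y) 1 :=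
      (mdifferentiable_mul_left_infty (E := E) g 1).continuousAt
    have hgs : g * 1 ∈ φ.source := by
      rw [mul_one]
      exact φ.map_target hx
    filter_upwards [hcont.preimage_mem_nhds ((isOpen_extChartAt_source (1 : G)).mem_nhds hgs),
      extChartAt_source_mem_nhds (I := 𝓘(ℝ, E)) (1 : G)] with y hy hy'
    simp only [Function.comp_apply, chartMul]
    rw [← hφ, φ.left_inv hy', φ.left_inv hy]
  have h := (hcomp2.congr_of_eventuallyEq heq).mfderiv
  exact DFunLike.congr_fun h v

/-- Solutions of the left-invariant equation in the chart at the unit give integral curves. -/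
theorem isMIntegralCurveOn_extChartAt_symm_comp {v : GroupLieAlgebra 𝓘(ℝ, E) G} {α : ℝ → E}
    {s : Set ℝ} (hα : ∀ t ∈ s, α t ∈ (extChartAt 𝓘(ℝ, E) (1 : G)).target ∧
      HasDerivAt α (chartFrame E G (α t) v) t) :
    IsMIntegralCurveOn (I := 𝓘(ℝ, E)) (fun t ↦ (extChartAt 𝓘(ℝ, E) (1 : G)).symm (α t))
      (fun x ↦ mulInvariantVectorField v x) s := by
  have : IsManifold 𝓘(ℝ, E) 1 G := IsManifold.of_le (n := ∞) (by exact_mod_cast le_top)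
  intro t ht
  obtain ⟨hmem, hder⟩ := hα t ht
  have hsymm : HasMFDerivAt 𝓘(ℝ, E) 𝓘(ℝ, E) (extChartAt 𝓘(ℝ, E) (1 : G)).symm (α t)
      (mfderiv 𝓘(ℝ, E) 𝓘(ℝ, E) (extChartAt 𝓘(ℝ, E) (1 : G)).symm (α t)) :=
    (((contMDiffOn_extChartAt_symm (n := 1) (1 : G)).contMDiffAt
      ((isOpen_extChartAt_target (I := 𝓘(ℝ, E)) (1 : G)).mem_nhds hmem)).mdifferentiableAt
        one_ne_zero).hasMFDerivAt
  have h := HasMFDerivAt.comp t (I' := 𝓘(ℝ, E)) hsymm hder.hasFDerivAt.hasMFDerivAt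
  have heq : ((1 : ℝ →L[ℝ] ℝ).smulRight
      (mulInvariantVectorField v ((extChartAt 𝓘(ℝ, E) (1 : G)).symm (α t))) : ℝ →L[ℝ] E) =
      (mfderiv 𝓘(ℝ, E) 𝓘(ℝ, E) (extChartAt 𝓘(ℝ, E) (1 : G)).symm (α t) : E →L[ℝ] E).comp
        (ContinuousLinearMap.toSpanSingleton ℝ (chartFrame E G (α t) v)) := by
    ext
    change (1 : ℝ) • (mulInvariantVectorField v _ : E) =
      (mfderiv 𝓘(ℝ, E) 𝓘(ℝ, E) (extChartAt 𝓘(ℝ, E) (1 : G)).symm (α t) : E →L[ℝ] E)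
        ((1 : ℝ) • chartFrame E G (α t) v)
    rw [one_smul, one_smul]
    exact mulInvariantVectorField_eq_mfderiv_chartFrame v hmem
  exact HasMFDerivAt.hasMFDerivWithinAt (heq ▸ h)

variable (E G) in
/-- In the chart at the unit, the exponential map is strictly differentiable at `0` with the
identity as its derivative. -/
theorem exists_lieExp_eq_extChartAt_symm [CompleteSpace E] [T2Space G] :
    ∃ Φ : E → E, HasStrictFDerivAt Φ (ContinuousLinearMap.id ℝ E) 0 ∧ Φ 0 = chartOne E G ∧
      ∀ᶠ v in 𝓝 (0 : E), lieExp (v : GroupLieAlgebra 𝓘(ℝ, E) G) =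
        (extChartAt 𝓘(ℝ, E) (1 : G)).symm (Φ v) := by
  obtain ⟨α, hα, hα0, hsol⟩ := exists_linear_ode_flow (contDiffAt_chartFrame (E := E) (G := G))
    chartFrame_chartOne
    ((isOpen_extChartAt_target (I := 𝓘(ℝ, E)) (1 : G)).mem_nhds chartOne_mem_target)
  refine ⟨fun v ↦ α v 1, hα, hα0, ?_⟩
  filter_upwards [hsol] with v hv
  exact lieExp_eq_of_isMIntegralCurveOn (by rw [hv.1, extChartAt_one_symm_chartOne])
    (isMIntegralCurveOn_extChartAt_symm_comp hv.2)

end LieGroupExp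

/-- Integral curves of continuous vector fields are `C^1`. -/
theorem IsMIntegralCurve.contMDiff_one {E : Type*} [NormedAddCommGroup E] [NormedSpace ℝ E]
    {M : Type*} [TopologicalSpace M] [ChartedSpace E M] [IsManifold 𝓘(ℝ, E) 1 M]
    {v : (x : M) → TangentSpace 𝓘(ℝ, E) x} {γ : ℝ → M}
    (hv : Continuous fun x ↦ (⟨x, v x⟩ : TangentBundle 𝓘(ℝ, E) M))
    (hγ : IsMIntegralCurve (I := 𝓘(ℝ, E)) γ v) : ContMDiff 𝓘(ℝ, ℝ) 𝓘(ℝ, E) 1 γ := by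
  intro t₀
  rw [contMDiffAt_iff_target, contMDiffAt_iff_contDiffAt]
  refine ⟨hγ.continuous.continuousAt, ?_⟩
  rw [contDiffAt_one_iff]
  have hopen : IsOpen (γ ⁻¹' (extChartAt 𝓘(ℝ, E) (γ t₀)).source) :=
    (isOpen_extChartAt_source (γ t₀)).preimage hγ.continuous
  refine ⟨fun t ↦ ContinuousLinearMap.toSpanSingleton ℝ
    (tangentCoordChange 𝓘(ℝ, E) (γ t) (γ t₀) (γ t) (v (γ t)) : E), _,
    hopen.mem_nhds (mem_extChartAt_source (I := 𝓘(ℝ, E)) (γ t₀)), ?_, fun t ht ↦ ?_⟩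
  -- The coordinate velocity is `v` along `γ` read in the trivialization at `γ t₀`, so it inherits
  -- the continuity of `v`.
  · have h1 : ContinuousOn (fun t ↦ (trivializationAt E (TangentSpace 𝓘(ℝ, E)) (γ t₀)
        (⟨γ t, v (γ t)⟩ : TangentBundle 𝓘(ℝ, E) M)).2)
        (γ ⁻¹' (extChartAt 𝓘(ℝ, E) (γ t₀)).source) := by
      refine continuous_snd.comp_continuousOn
        ((trivializationAt E (TangentSpace 𝓘(ℝ, E)) (γ t₀)).continuousOn.comp
          (hv.comp hγ.continuous).continuousOn fun t ht ↦ ?_)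
      simpa [extChartAt_source] using ht
    exact ((ContinuousLinearMap.toSpanSingletonCLE (𝕜 := ℝ) (E := E)).continuous).comp_continuousOn h1
  · exact ((hγ.isMIntegralCurveOn univ).hasDerivWithinAt (t₀ := t₀) (mem_univ t)
      ht).hasDerivAt Filter.univ_mem |>.hasFDerivAt

/-! ### Invariance of the metric and the lower bound. -/

section Homogeneous

variable {E : Type*} [NormedAddCommGroup E] [NormedSpace ℝ E]
  {F : Type*} [NormedAddCommGroup F] [NormedSpace ℝ F]
  {G : Type*} [TopologicalSpace G] [ChartedSpace E G] [Group G] [LieGroup 𝓘(ℝ, E) ∞ G]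
  {H : Subgroup G} [ChartedSpace F (G ⧸ H)]
  [RiemannianBundle (fun p : G ⧸ H ↦ TangentSpace 𝓘(ℝ, F) p)]

theorem IsInvariantMetric.enorm_mfderiv_smul (hinv : IsInvariantMetric (F := F) H) (g : G)
    (p : G ⧸ H) (w : TangentSpace 𝓘(ℝ, F) p) :
    ‖mfderiv 𝓘(ℝ, F) 𝓘(ℝ, F) (fun q : G ⧸ H ↦ g • q) p w‖ₑ = ‖w‖ₑ := by
  rw [← ofReal_norm, ← ofReal_norm, norm_eq_sqrt_real_inner, norm_eq_sqrt_real_inner, hinv]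

/-- Where a map is not differentiable, `mfderiv` is `0` by convention, and `0` cannot preserve the
norm of a nonzero vector. -/
theorem IsInvariantMetric.mdifferentiableAt_smul [Nontrivial F]
    (hinv : IsInvariantMetric (F := F) H) (g : G) (p : G ⧸ H) :
    MDifferentiableAt 𝓘(ℝ, F) 𝓘(ℝ, F) (fun q : G ⧸ H ↦ g • q) p := by
  by_contra h
  obtain ⟨w, hw⟩ : ∃ w : TangentSpace 𝓘(ℝ, F) p, w ≠ 0 := exists_ne (α := F) 0
  have h1 := hinv.enorm_mfderiv_smul g p w
  rw [mfderiv_zero_of_not_mdifferentiableAt h] at h1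
  exact hw (enorm_eq_zero.1 (h1.symm.trans enorm_zero))

/-- The projection intertwines left translation on `G` with the action on `G ⧸ H`; differentiating
both composites at the unit reduces the claim to invariance of the metric. -/
theorem pullbackSeminorm_mulInvariantVectorField (hinv : IsInvariantMetric (F := F) H)
    (hπ : MDifferentiable 𝓘(ℝ, E) 𝓘(ℝ, F) (fun x : G ↦ (x : G ⧸ H)))
    (v : GroupLieAlgebra 𝓘(ℝ, E) G) (g : G) :
    pullbackSeminorm (F := F) H g (mulInvariantVectorField v g) =
      pullbackSeminorm (F := F) H (1 : G) v := by
  rcases subsingleton_or_nontrivial F with hF | hF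
  · have h0 : ∀ (p : G ⧸ H) (w : TangentSpace 𝓘(ℝ, F) p), ‖w‖ₑ = 0 := fun p w ↦
      enorm_eq_zero.2 (Subsingleton.elim (α := F) w 0)
    rw [pullbackSeminorm, pullbackSeminorm, h0, h0]
  have hcomp : (fun q : G ⧸ H ↦ g • q) ∘ (fun x : G ↦ (x : G ⧸ H)) =
      (fun x : G ↦ (x : G ⧸ H)) ∘ fun x ↦ g * x := rfl
  have h1 := mfderiv_comp (I' := 𝓘(ℝ, F)) (1 : G)
    (hinv.mdifferentiableAt_smul g ((1 : G) : G ⧸ H)) (hπ 1)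
  have h2 := mfderiv_comp (I' := 𝓘(ℝ, E)) (1 : G) (hπ (g * 1))
    (mdifferentiable_mul_left_infty (E := E) g 1)
  rw [hcomp, h2] at h1
  have h3 := hinv.enorm_mfderiv_smul g _ (mfderiv 𝓘(ℝ, E) 𝓘(ℝ, F) (fun x : G ↦ (x : G ⧸ H)) 1 v)
  rw [pullbackSeminorm, pullbackSeminorm, ← h3]
  -- The chain rule lands at `g * 1`, whose tangent space must be transported to that at `g`.
  have h4 : ∀ x : G, x = g → ‖(mfderiv 𝓘(ℝ, E) 𝓘(ℝ, F) (fun x : G ↦ (x : G ⧸ H)) x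
      (mulInvariantVectorField v g : E) : TangentSpace 𝓘(ℝ, F) (x : G ⧸ H))‖ₑ =
      ‖(mfderiv 𝓘(ℝ, E) 𝓘(ℝ, F) (fun x : G ↦ (x : G ⧸ H)) g
      (mulInvariantVectorField v g) : TangentSpace 𝓘(ℝ, F) (g : G ⧸ H))‖ₑ := by
    rintro x rfl
    rfl
  refine (h4 (g * 1) (mul_one g)).symm.trans ?_
  exact congrArg (fun w : TangentSpace 𝓘(ℝ, F) ((g * 1 : G) : G ⧸ H) ↦ ‖w‖ₑ)
    (DFunLike.congr_fun h1 v)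

/-- The projected integral curve has constant speed, so its length over `[0, 1]` is that speed. -/
theorem riemannianEDist_coe_lieExp_le [CompleteSpace E] [T2Space G]
    (hinv : IsInvariantMetric (F := F) H)
    (hπ : ContMDiff 𝓘(ℝ, E) 𝓘(ℝ, F) ∞ (fun x : G ↦ (x : G ⧸ H)))
    (v : GroupLieAlgebra 𝓘(ℝ, E) G) :
    riemannianEDist 𝓘(ℝ, F) ((1 : G) : G ⧸ H) (lieExp v : G) ≤
      pullbackSeminorm (F := F) H (1 : G) v := by
  have : IsManifold 𝓘(ℝ, E) 1 G := IsManifold.of_le (n := ∞) (by exact_mod_cast le_top)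
  obtain ⟨γ, hγ0, hγ⟩ := exists_isMIntegralCurve_mulInvariantVectorField v
  have hγ1 := lieExp_eq_of_isMIntegralCurveOn hγ0 (hγ.isMIntegralCurveOn _)
  have hsmooth : ContMDiff 𝓘(ℝ, ℝ) 𝓘(ℝ, F) 1 (fun t ↦ (γ t : G ⧸ H)) :=
    (hπ.of_le (by exact_mod_cast le_top)).comp
      (hγ.contMDiff_one (contMDiff_mulInvariantVectorField_one v).continuous)
  have hπ' := hπ.mdifferentiable (by simp)
  refine (riemannianEDist_le_pathELength (I := 𝓘(ℝ, F)) (γ := fun t ↦ (γ t : G ⧸ H))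
    (a := 0) (b := 1) hsmooth.contMDiffOn (by rw [hγ0]) (by rw [hγ1]) zero_le_one).trans ?_
  rw [pathELength_eq_lintegral_mfderiv_Icc]
  have hspeed : ∀ t, ‖mfderiv 𝓘(ℝ, ℝ) 𝓘(ℝ, F) (fun t ↦ (γ t : G ⧸ H)) t 1‖ₑ =
      pullbackSeminorm (F := F) H (1 : G) v := by
    intro t
    rw [← pullbackSeminorm_mulInvariantVectorField hinv hπ' v (γ t), pullbackSeminorm]
    have h := (HasMFDerivAt.comp t (I' := 𝓘(ℝ, E)) (hπ' (γ t)).hasMFDerivAt (hγ t)).mfderiv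
    refine congrArg (fun w : TangentSpace 𝓘(ℝ, F) (γ t : G ⧸ H) ↦ ‖w‖ₑ)
      ((DFunLike.congr_fun h (1 : ℝ)).trans ?_)
    change (mfderiv 𝓘(ℝ, E) 𝓘(ℝ, F) (fun x : G ↦ (x : G ⧸ H)) (γ t) : E →L[ℝ] F)
      ((1 : ℝ) • (mulInvariantVectorField v (γ t) : E)) = _
    rw [one_smul]
  simp_rw [hspeed]
  simp

omit [LieGroup 𝓘(ℝ, E) ∞ G] in
theorem IsLogRange.lieExp_lieLog {V : Set (GroupLieAlgebra 𝓘(ℝ, E) G)} (hV : IsLogRange V)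
    (g : G) : lieExp (lieLog V g) = g :=
  Function.invFunOn_eq (hV.bijOn.surjOn (mem_univ g))

omit [LieGroup 𝓘(ℝ, E) ∞ G] in
theorem IsLogRange.lieLog_lieExp {V : Set (GroupLieAlgebra 𝓘(ℝ, E) G)} (hV : IsLogRange V)
    {v : GroupLieAlgebra 𝓘(ℝ, E) G} (hv : v ∈ V) : lieLog V (lieExp v) = v :=
  hV.bijOn.injOn.leftInvOn_invFunOn hv

theorem riemannianEDist_le_logMetricEstimate [CompleteSpace E] [T2Space G]
    (hinv : IsInvariantMetric (F := F) H)
    (hπ : ContMDiff 𝓘(ℝ, E) 𝓘(ℝ, F) ∞ (fun x : G ↦ (x : G ⧸ H)))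
    {V : Set (GroupLieAlgebra 𝓘(ℝ, E) G)} (hV : IsLogRange V) (p : G ⧸ H) :
    riemannianEDist 𝓘(ℝ, F) ((1 : G) : G ⧸ H) p ≤ logMetricEstimate (F := F) H V p := by
  refine le_iInf₂ ?_
  rintro g rfl
  have h := riemannianEDist_coe_lieExp_le hinv hπ (lieLog V g)
  rwa [hV.lieExp_lieLog] at h

end Homogeneous

/-! ### Chart distance against Riemannian distance. -/

section ChartDistance

attribute [local instance] normedAddCommGroupTangentSpaceVectorSpace
attribute [local instance] normedSpaceTangentSpaceVectorSpace

variable {F : Type*} [NormedAddCommGroup F] [NormedSpace ℝ F]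
    {B : Type*} [TopologicalSpace B] {I : ModelWithCorners ℝ F B}
    {M : Type*} [TopologicalSpace M] [ChartedSpace B M]
    [IsManifold I 1 M] [RiemannianBundle (fun x : M ↦ TangentSpace I x)]
    [IsContinuousRiemannianBundle F (fun x : M ↦ TangentSpace I x)]

theorem eventually_enorm_mfderiv_extChartAt_apply_le (x : M) :
    ∃ C : ℝ≥0, 0 < C ∧ ∀ᶠ y in 𝓝 x, ∀ w : TangentSpace I y,
      ‖(show F from mfderiv I 𝓘(ℝ, F) (extChartAt I x) y w)‖ₑ ≤ C * ‖w‖ₑ := by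
  obtain ⟨C, hC0, hC⟩ := eventually_enorm_mfderiv_extChartAt_lt I x
  refine ⟨C, hC0, ?_⟩
  filter_upwards [hC] with y hy w
  exact (ContinuousLinearMap.le_opENorm _ w).trans (mul_le_mul_left hy.le ‖w‖ₑ)

/-- Near a point, the distance in the chart is bounded by a multiple of the Riemannian distance. -/
theorem exists_edist_extChartAt_le_riemannianEDist [RegularSpace M] (x : M) :
    ∃ C : ℝ≥0, ∃ c : ℝ≥0∞, 0 < c ∧ ∀ y, riemannianEDist I x y < c →
      edist (extChartAt I x x) (extChartAt I x y) ≤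
        C * riemannianEDist I x y := by
  obtain ⟨C, hC0, hC⟩ := eventually_enorm_mfderiv_extChartAt_apply_le (I := I) x
  obtain ⟨c, hc, hsub⟩ := setOfPred_riemannianEDist_lt_subset_nhds' I
    (Filter.inter_mem hC (chart_source_mem_nhds B x))
  refine ⟨C, c, hc, fun y hy ↦ ?_⟩
  rw [mul_comm, ← ENNReal.div_le_iff_le_mul (by simp [hC0.ne']) (by simp)]
  refine le_of_forall_gt fun r' hr' ↦ ?_
  -- With `r` below `c` as well, a path of length less than `r` from `x` never leaves the region
  -- where the chart is defined and its derivative is bounded.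
  obtain ⟨r, hr, hrlt⟩ := exists_between (lt_min hr' hy)
  obtain ⟨γ, hγ0, hγ1, hγ, hlen, -⟩ := exists_lt_locally_constant_of_riemannianEDist_lt
    hr zero_lt_one
  have hmem : ∀ t ∈ Icc (0 : ℝ) 1, (∀ w : TangentSpace I (γ t),
      ‖(show F from mfderiv I 𝓘(ℝ, F) (extChartAt I x) (γ t) w)‖ₑ ≤ C * ‖w‖ₑ) ∧
      γ t ∈ (chartAt B x).source := by
    intro t ht
    refine hsub (a := γ t) (lt_of_le_of_lt ?_ (hrlt.trans_le (min_le_right _ _)))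
    exact (riemannianEDist_le_pathELength hγ.contMDiffOn hγ0 rfl ht.1).trans
      ((pathELength_mono le_rfl ht.2).trans hlen.le)
  set η := extChartAt I x ∘ γ with hη
  have hηC : ContMDiffOn 𝓘(ℝ, ℝ) 𝓘(ℝ, F) 1 η (Icc 0 1) :=
    contMDiffOn_extChartAt.comp (I' := I) (t := (chartAt B x).source)
      hγ.contMDiffOn fun t ht ↦ (hmem t ht).2
  have hle : ‖η 1 - η 0‖ₑ ≤ C * r := by
    calc ‖η 1 - η 0‖ₑ
        ≤ ∫⁻ t in Icc (0 : ℝ) 1, ‖derivWithin η (Icc 0 1) t‖ₑ :=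
          enorm_sub_le_lintegral_derivWithin_Icc_of_contDiffOn_Icc
            (contMDiffOn_iff_contDiffOn.1 hηC) zero_le_one
      _ = ∫⁻ t in Icc (0 : ℝ) 1, ‖mfderivWithin 𝓘(ℝ, ℝ) 𝓘(ℝ, F) η (Icc 0 1) t 1‖ₑ := by
          simp_rw [← fderivWithin_derivWithin, mfderivWithin_eq_fderivWithin]
          rfl
      _ ≤ ∫⁻ t in Icc (0 : ℝ) 1, C * ‖mfderivWithin 𝓘(ℝ, ℝ) I γ (Icc 0 1) t 1‖ₑ := by
          refine MeasureTheory.setLIntegral_mono' measurableSet_Icc fun t ht ↦ ?_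
          have h1 : mfderivWithin 𝓘(ℝ, ℝ) 𝓘(ℝ, F) η (Icc 0 1) t =
              (mfderiv I 𝓘(ℝ, F) (extChartAt I x) (γ t)) ∘L
                (mfderivWithin 𝓘(ℝ, ℝ) I γ (Icc 0 1) t) := by
            apply mfderiv_comp_mfderivWithin
            · exact mdifferentiableAt_extChartAt (hmem t ht).2
            · exact (hγ.mdifferentiable one_ne_zero).mdifferentiableOn _ ht
            · rw [uniqueMDiffWithinAt_iff_uniqueDiffWithinAt]
              exact uniqueDiffOn_Icc zero_lt_one _ ht
          have h2 : mfderivWithin 𝓘(ℝ, ℝ) 𝓘(ℝ, F) η (Icc 0 1) t 1 =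
              (mfderiv I 𝓘(ℝ, F) (extChartAt I x) (γ t))
                (mfderivWithin 𝓘(ℝ, ℝ) I γ (Icc 0 1) t 1) := congr($h1 1)
          rw [h2]
          exact (hmem t ht).1 _
      _ = C * pathELength I γ 0 1 := by
          rw [MeasureTheory.lintegral_const_mul' _ _ ENNReal.coe_ne_top,
            pathELength_eq_lintegral_mfderivWithin_Icc]
      _ ≤ C * r := by gcongr
  rw [edist_comm, edist_eq_enorm_sub]
  have h0 : η 0 = extChartAt I x x := by simp [hη, hγ0]
  have h1 : η 1 = extChartAt I x y := by simp [hη, hγ1]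
  rw [h0, h1] at hle
  refine lt_of_le_of_lt ?_ (hrlt.trans_le (min_le_left _ _))
  exact ENNReal.div_le_of_le_mul (by rwa [mul_comm])

end ChartDistance

/-! ### Controlled preimages from a surjective derivative. -/

/-- A map that is strictly differentiable at `0` with surjective derivative has, near the image of
`0`, preimages whose norm is controlled linearly. -/
theorem HasStrictFDerivAt.exists_preimage_enorm_le {E F : Type*} [NormedAddCommGroup E]
    [NormedSpace ℝ E] [NormedAddCommGroup F] [NormedSpace ℝ F] [FiniteDimensional ℝ F]
    {f : E → F} {A : E →L[ℝ] F} (hf : HasStrictFDerivAt f A 0) (hA : Function.Surjective A) :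
    ∃ (C : ℝ≥0) (σ : F → E), Filter.Tendsto σ (𝓝 (f 0)) (𝓝 0) ∧
      ∀ᶠ y in 𝓝 (f 0), f (σ y) = y ∧ ‖σ y‖ₑ ≤ C * edist (f 0) y := by
  have : CompleteSpace F := FiniteDimensional.complete ℝ F
  -- Precomposing `f` with a linear right inverse of `A` makes the derivative the identity of `F`,
  -- so the ordinary inverse function theorem suffices.
  obtain ⟨R, hR⟩ := (A : E →ₗ[ℝ] F).exists_rightInverse_of_surjective (LinearMap.range_eq_top.2 hA)
  set R' : F →L[ℝ] E := LinearMap.toContinuousLinearMap R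
  have hAR : A.comp R' = (ContinuousLinearEquiv.refl ℝ F : F →L[ℝ] F) := by
    ext y
    exact LinearMap.congr_fun hR y
  have hg : HasStrictFDerivAt (f ∘ R') (ContinuousLinearEquiv.refl ℝ F : F →L[ℝ] F) 0 := by
    rw [← hAR]
    refine HasStrictFDerivAt.comp (0 : F) ?_ R'.hasStrictFDerivAt
    rwa [map_zero]
  have hg0 : (f ∘ R') 0 = f 0 := by simp
  have hloc := hg.to_localInverse
  have hinv := hg.eventually_right_inverse
  have himg := hg.localInverse_apply_image
  rw [hg0] at hloc hinv himg
  set τ := hg.localInverse (f ∘ R') _ 0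
  have hτ0 : τ (f 0) = 0 := himg
  obtain ⟨c, hc⟩ := hloc.hasFDerivAt.isBigO_sub.bound
  -- The big-O constant `c` has no known sign, hence its positive part.
  refine ⟨‖R'‖₊ * c.toNNReal, fun y ↦ R' (τ y), ?_, ?_⟩
  · have h := (R'.continuous.continuousAt.comp hloc.continuousAt).tendsto
    simpa [Function.comp_def, hτ0] using h
  · filter_upwards [hinv, hc] with y hy hcy
    refine ⟨hy, ?_⟩
    rw [hτ0, sub_zero] at hcy
    have h1 : ‖R' (τ y)‖₊ ≤ ‖R'‖₊ * c.toNNReal * ‖f 0 - y‖₊ := by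
      rw [← NNReal.coe_le_coe]
      push_cast
      rw [norm_sub_rev]
      calc ‖R' (τ y)‖ ≤ ‖R'‖ * ‖τ y‖ := R'.le_opNorm _
        _ ≤ ‖R'‖ * (max c 0 * ‖y - f 0‖) := by
          gcongr
          exact hcy.trans (by gcongr; exact le_max_left _ _)
        _ = _ := by rw [Real.coe_toNNReal']; ring
    rw [edist_eq_enorm_sub]
    simp only [enorm_eq_nnnorm]
    exact_mod_cast h1

/-! ### The upper bound on compact sets. -/

section Homogeneous

variable {E : Type*} [NormedAddCommGroup E] [NormedSpace ℝ E] [FiniteDimensional ℝ E]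
  {F : Type*} [NormedAddCommGroup F] [NormedSpace ℝ F] [FiniteDimensional ℝ F]
  {G : Type*} [TopologicalSpace G] [ChartedSpace E G] [Group G] [LieGroup 𝓘(ℝ, E) ∞ G]
  {H : Subgroup G} [ChartedSpace F (G ⧸ H)]

/-- Points near the base point are projections of exponentials of vectors in `V` of controlled
size. -/
theorem exists_lieExp_preimage_enorm_le [T2Space G] [IsManifold 𝓘(ℝ, F) ∞ (G ⧸ H)]
    (hπ : ContMDiff 𝓘(ℝ, E) 𝓘(ℝ, F) ∞ (fun x : G ↦ (x : G ⧸ H)))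
    (hπ' : Function.Surjective (mfderiv 𝓘(ℝ, E) 𝓘(ℝ, F) (fun x : G ↦ (x : G ⧸ H)) 1))
    {V : Set E} (hV : V ∈ 𝓝 0) :
    ∃ C : ℝ≥0, ∀ᶠ p in 𝓝 ((1 : G) : G ⧸ H), ∃ v ∈ V,
      ((lieExp (v : GroupLieAlgebra 𝓘(ℝ, E) G) : G) : G ⧸ H) = p ∧
      ‖v‖ₑ ≤ C * edist (extChartAt 𝓘(ℝ, F) ((1 : G) : G ⧸ H) (1 : G))
        (extChartAt 𝓘(ℝ, F) ((1 : G) : G ⧸ H) p) := by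
  have : CompleteSpace E := FiniteDimensional.complete ℝ E
  obtain ⟨Φ, hΦ, hΦ0, hexp⟩ := exists_lieExp_eq_extChartAt_symm E G
  set φ := extChartAt 𝓘(ℝ, E) (1 : G) with hφ
  set ψ := extChartAt 𝓘(ℝ, F) ((1 : G) : G ⧸ H) with hψ
  have hcd : ContDiffAt ℝ ∞ (writtenInExtChartAt 𝓘(ℝ, E) 𝓘(ℝ, F) 1 (fun x : G ↦ (x : G ⧸ H)))
      (chartOne E G) := by
    have h := (contMDiffAt_iff.1 (hπ 1)).2
    rwa [ModelWithCorners.range_eq_univ, contDiffWithinAt_univ] at h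
  have hA := hcd.hasStrictFDerivAt (by simp)
  have hsurj : Function.Surjective
      (fderiv ℝ (writtenInExtChartAt 𝓘(ℝ, E) 𝓘(ℝ, F) 1 (fun x : G ↦ (x : G ⧸ H)))
        (chartOne E G)) := by
    rw [(hπ.mdifferentiable (by simp) 1).mfderiv, ModelWithCorners.range_eq_univ,
      fderivWithin_univ] at hπ'
    exact hπ'
  set f : E → F := writtenInExtChartAt 𝓘(ℝ, E) 𝓘(ℝ, F) 1 (fun x : G ↦ (x : G ⧸ H)) ∘ Φ with hf
  have hfv : ∀ v, f v = ψ ((φ.symm (Φ v) : G) : G ⧸ H) := fun v ↦ rfl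
  rw [← hΦ0] at hA hsurj
  have hfs := hA.comp (0 : E) hΦ
  change HasStrictFDerivAt f _ 0 at hfs
  have hf0 : f 0 = ψ ((1 : G) : G ⧸ H) := by
    rw [hfv, hΦ0, hφ, extChartAt_one_symm_chartOne]
  obtain ⟨C, σ, hσ, hσC⟩ := hfs.exists_preimage_enorm_le (by simpa using hsurj)
  rw [hf0] at hσ hσC
  have hψc : Filter.Tendsto ψ (𝓝 ((1 : G) : G ⧸ H)) (𝓝 (ψ ((1 : G) : G ⧸ H))) :=
    (continuousAt_extChartAt (I := 𝓘(ℝ, F)) _).tendsto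
  -- The chart `ψ` is injective only on its source, so equality of coordinates gives equality of
  -- points only once both lie there.
  have hsrc : ∀ᶠ v in 𝓝 (0 : E), ((φ.symm (Φ v) : G) : G ⧸ H) ∈ ψ.source := by
    have hcont : ContinuousAt (fun v ↦ ((φ.symm (Φ v) : G) : G ⧸ H)) 0 := by
      refine hπ.continuous.continuousAt.comp (ContinuousAt.comp ?_ hΦ.continuousAt)
      rw [hΦ0]
      exact continuousAt_extChartAt_symm (I := 𝓘(ℝ, E)) (1 : G)
    refine hcont.preimage_mem_nhds ?_
    rw [hΦ0, hφ, extChartAt_one_symm_chartOne]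
    exact extChartAt_source_mem_nhds (I := 𝓘(ℝ, F)) _
  refine ⟨C, ?_⟩
  filter_upwards [hψc.eventually hσC, (hσ.comp hψc).eventually hV,
    (hσ.comp hψc).eventually hexp, (hσ.comp hψc).eventually hsrc,
    extChartAt_source_mem_nhds (I := 𝓘(ℝ, F)) ((1 : G) : G ⧸ H)] with p h1 h2 h3 h4 h5
  refine ⟨σ (ψ p), h2, ?_, h1.2⟩
  rw [Function.comp_apply] at h3 h4
  rw [h3]
  exact ψ.injOn h4 h5 h1.1

variable [RiemannianBundle (fun p : G ⧸ H ↦ TangentSpace 𝓘(ℝ, F) p)]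

omit [FiniteDimensional ℝ E] [FiniteDimensional ℝ F] [LieGroup 𝓘(ℝ, E) ∞ G] in
theorem exists_pullbackSeminorm_le :
    ∃ M : ℝ≥0, ∀ v : E,
      pullbackSeminorm (F := F) H (1 : G) (v : GroupLieAlgebra 𝓘(ℝ, E) G) ≤ M * ‖v‖ₑ := by
  let A : E →L[ℝ] TangentSpace 𝓘(ℝ, F) ((1 : G) : G ⧸ H) :=
    mfderiv 𝓘(ℝ, E) 𝓘(ℝ, F) (fun x : G ↦ (x : G ⧸ H)) 1
  exact ⟨‖A‖₊, fun v ↦ A.le_opENorm v⟩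

omit [FiniteDimensional ℝ E] [FiniteDimensional ℝ F] [LieGroup 𝓘(ℝ, E) ∞ G] in
theorem logMetricEstimate_le (V : Set (GroupLieAlgebra 𝓘(ℝ, E) G)) {g : G} {p : G ⧸ H}
    (hg : (g : G ⧸ H) = p) :
    logMetricEstimate (F := F) H V p ≤ pullbackSeminorm (F := F) H (1 : G) (lieLog V g) :=
  iInf₂_le (f := fun (x : G) (_ : (x : G ⧸ H) = p) ↦
    pullbackSeminorm (F := F) H (1 : G) (lieLog V x)) g hg

omit [FiniteDimensional ℝ F] in
/-- The logarithmic estimate is bounded on compact sets. -/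
theorem exists_logMetricEstimate_le_of_isCompact
    {V : Set (GroupLieAlgebra 𝓘(ℝ, E) G)} (hV : IsLogRange V) {K : Set (G ⧸ H)}
    (hK : IsCompact K) : ∃ B : ℝ≥0, ∀ p ∈ K, logMetricEstimate (F := F) H V p ≤ B := by
  have : IsTopologicalGroup G := topologicalGroup_of_lieGroup 𝓘(ℝ, E) ∞
  have : LocallyCompactSpace G := Manifold.locallyCompact_of_finiteDimensional 𝓘(ℝ, E)
  -- The projection is open, so images of compact neighbourhoods in `G` are neighbourhoods in `G ⧸
  -- H`, and finitely many of them cover `K`.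
  obtain ⟨K', hK', hKK'⟩ : ∃ K' : Set G, IsCompact K' ∧ K ⊆ (fun x : G ↦ (x : G ⧸ H)) '' K' := by
    refine hK.induction_on (p := fun K ↦ ∃ K' : Set G, IsCompact K' ∧
      K ⊆ (fun x : G ↦ (x : G ⧸ H)) '' K') ⟨∅, isCompact_empty, empty_subset _⟩
      (fun s t hst ⟨K', h1, h2⟩ ↦ ⟨K', h1, hst.trans h2⟩)
      (fun s t ⟨K₁, h1, h2⟩ ⟨K₂, h3, h4⟩ ↦ ⟨K₁ ∪ K₂, h1.union h3, ?_⟩) fun p _ ↦ ?_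
    · rw [image_union]
      exact union_subset_union h2 h4
    · obtain ⟨g, rfl⟩ := QuotientGroup.mk_surjective p
      obtain ⟨N, hN, hgN⟩ := exists_compact_mem_nhds g
      exact ⟨_, mem_nhdsWithin_of_mem_nhds (QuotientGroup.isOpenMap_coe.image_mem_nhds hgN), N, hN,
        subset_rfl⟩
  obtain ⟨S, hS, hlog⟩ := hV.bounded K' hK'
  obtain ⟨M, hM⟩ := exists_pullbackSeminorm_le (E := E) (F := F) (G := G) (H := H)
  obtain ⟨r, hr⟩ : ∃ r : ℝ≥0, ∀ v : E, v ∈ S → ‖v‖ₑ ≤ r := by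
    obtain ⟨r, hr⟩ := (IsCompact.isBounded (α := E) hS).exists_norm_le
    refine ⟨r.toNNReal, fun v hv ↦ ?_⟩
    rw [← ofReal_norm]
    exact ENNReal.ofReal_le_ofReal (hr v hv)
  refine ⟨M * r, fun p hp ↦ ?_⟩
  obtain ⟨g, hg, rfl⟩ := hKK' hp
  refine (logMetricEstimate_le (F := F) V rfl).trans ((hM _).trans ?_)
  push_cast
  gcongr
  exact hr _ (hlog (mem_image_of_mem _ hg))

/-- The logarithmic estimate is comparable to the distance on compact sets. -/
theorem exists_logMetricEstimate_le_mul_riemannianEDist [T2Space G]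
    (hH : IsCompact (H : Set G)) [IsManifold 𝓘(ℝ, F) ∞ (G ⧸ H)]
    (hπ : ContMDiff 𝓘(ℝ, E) 𝓘(ℝ, F) ∞ (fun x : G ↦ (x : G ⧸ H)))
    (hπ' : Function.Surjective (mfderiv 𝓘(ℝ, E) 𝓘(ℝ, F) (fun x : G ↦ (x : G ⧸ H)) 1))
    [IsContMDiffRiemannianBundle 𝓘(ℝ, F) ∞ F (fun p : G ⧸ H ↦ TangentSpace 𝓘(ℝ, F) p)]
    {V : Set (GroupLieAlgebra 𝓘(ℝ, E) G)} (hV : IsLogRange V) {K : Set (G ⧸ H)}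
    (hK : IsCompact K) :
    ∃ C : ℝ≥0, ∀ p ∈ K, logMetricEstimate (F := F) H V p ≤
      C * riemannianEDist 𝓘(ℝ, F) ((1 : G) : G ⧸ H) p := by
  have : IsTopologicalGroup G := topologicalGroup_of_lieGroup 𝓘(ℝ, E) ∞
  -- Closedness of `H` and local compactness supply the regularity of `G ⧸ H` needed by the distance
  -- lemmas.
  have : IsClosed (H : Set G) := hH.isClosed
  have : LocallyCompactSpace (G ⧸ H) := Manifold.locallyCompact_of_finiteDimensional 𝓘(ℝ, F)
  have : IsManifold 𝓘(ℝ, F) 1 (G ⧸ H) := IsManifold.of_le (n := ∞) (by exact_mod_cast le_top)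
  have : IsContinuousRiemannianBundle F (fun p : G ⧸ H ↦ TangentSpace 𝓘(ℝ, F) p) := by
    obtain ⟨g, hg, hg'⟩ := IsContMDiffRiemannianBundle.exists_contMDiff (IB := 𝓘(ℝ, F)) (n := ∞)
      (F := F) (E := fun p : G ⧸ H ↦ TangentSpace 𝓘(ℝ, F) p)
    exact ⟨g, hg.continuous, hg'⟩
  obtain ⟨C₁, hC₁⟩ := exists_lieExp_preimage_enorm_le hπ hπ' (V := V) hV.mem_nhds
  obtain ⟨C₂, c, hc, hC₂⟩ := exists_edist_extChartAt_le_riemannianEDist (I := 𝓘(ℝ, F))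
    ((1 : G) : G ⧸ H)
  obtain ⟨δ, hδ, hsub⟩ := setOfPred_riemannianEDist_lt_subset_nhds 𝓘(ℝ, F) hC₁
  obtain ⟨M, hM⟩ := exists_pullbackSeminorm_le (E := E) (F := F) (G := G) (H := H)
  obtain ⟨B, hB⟩ := exists_logMetricEstimate_le_of_isCompact (F := F) hV hK
  obtain ⟨ε, hε, hεc⟩ := ENNReal.lt_iff_exists_nnreal_btwn.1
    (lt_min hc (ENNReal.coe_pos.2 hδ))
  rw [ENNReal.coe_pos] at hε
  -- The first constant serves at distance below `ε`, where both local estimates hold; the second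
  -- serves beyond, where `ρ ≤ B` and `d ≥ ε`.
  refine ⟨max (M * (C₁ * C₂)) (B / ε), fun p hp ↦ ?_⟩
  rcases lt_or_ge (riemannianEDist 𝓘(ℝ, F) ((1 : G) : G ⧸ H) p) ε with hlt | hge
  · obtain ⟨v, hvV, hvp, hv⟩ := hsub (a := p) (hlt.trans (hεc.trans_le (min_le_right _ _)))
    have h1 : logMetricEstimate (F := F) H V p ≤ M * ‖v‖ₑ := by
      refine (logMetricEstimate_le (F := F) V hvp).trans ?_
      -- Because `v ∈ V`, the logarithm returns `v` itself, so no continuity of `log` enters.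
      rw [hV.lieLog_lieExp hvV]
      exact hM v
    have h2 := hC₂ p (hlt.trans (hεc.trans_le (min_le_left _ _)))
    calc logMetricEstimate (F := F) H V p
        ≤ M * (C₁ * (C₂ * riemannianEDist 𝓘(ℝ, F) ((1 : G) : G ⧸ H) p)) := by
          refine h1.trans ?_
          gcongr
          exact hv.trans (by gcongr)
      _ = ((M * (C₁ * C₂) : ℝ≥0) : ℝ≥0∞) * riemannianEDist 𝓘(ℝ, F) ((1 : G) : G ⧸ H) p := by
          push_cast
          ring
      _ ≤ _ := by
          gcongr
          exact le_max_left _ _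
  · calc logMetricEstimate (F := F) H V p ≤ B := hB p hp
      _ = ((B / ε : ℝ≥0) : ℝ≥0∞) * ε := by
          rw [← ENNReal.coe_mul, div_mul_cancel₀ _ hε.ne']
      _ ≤ _ := by
          gcongr
          exact le_max_right _ _

end Homogeneous

theorem mainTheorem3
    {E : Type*} [NormedAddCommGroup E] [NormedSpace ℝ E] [FiniteDimensional ℝ E]
    {F : Type*} [NormedAddCommGroup F] [NormedSpace ℝ F] [FiniteDimensional ℝ F]
    -- a connected Lie group `G` and a compact connected subgroup `H`
    {G : Type*} [TopologicalSpace G] [T2Space G] [ConnectedSpace G] [ChartedSpace E G] [Group G]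
    [LieGroup 𝓘(ℝ, E) ∞ G]
    (H : Subgroup G) (hHcompact : IsCompact (H : Set G)) (hHconn : IsConnected (H : Set G))
    -- the smooth structure of `G ⧸ H`: the one for which `π` is a smooth submersion
    [ChartedSpace F (G ⧸ H)] [IsManifold 𝓘(ℝ, F) ∞ (G ⧸ H)]
    (hπ : ContMDiff 𝓘(ℝ, E) 𝓘(ℝ, F) ∞ (fun x : G ↦ (x : G ⧸ H)))
    (hπ' : ∀ g : G, Function.Surjective (mfderiv 𝓘(ℝ, E) 𝓘(ℝ, F) (fun x : G ↦ (x : G ⧸ H)) g))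
    -- a `G`-invariant Riemannian metric on `G ⧸ H`
    [RiemannianBundle (fun p : G ⧸ H ↦ TangentSpace 𝓘(ℝ, F) p)]
    [IsContMDiffRiemannianBundle 𝓘(ℝ, F) ∞ F (fun p : G ⧸ H ↦ TangentSpace 𝓘(ℝ, F) p)]
    (hinv : IsInvariantMetric (F := F) H)
    -- the range of the logarithm
    (V : Set (GroupLieAlgebra 𝓘(ℝ, E) G)) (hV : IsLogRange V) :
    (∀ p : G ⧸ H,
      riemannianEDist 𝓘(ℝ, F) ((1 : G) : G ⧸ H) p ≤ logMetricEstimate (F := F) H V p) ∧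
    ∀ K : Set (G ⧸ H), IsCompact K → K ∈ 𝓝 ((1 : G) : G ⧸ H) →
      Disjoint K (cutLocus (F := F) ((1 : G) : G ⧸ H)) →
      ∃ C : ℝ≥0, 1 ≤ C ∧ ∀ p ∈ K,
        riemannianEDist 𝓘(ℝ, F) ((1 : G) : G ⧸ H) p ≤ logMetricEstimate (F := F) H V p ∧
        logMetricEstimate (F := F) H V p ≤ C * riemannianEDist 𝓘(ℝ, F) ((1 : G) : G ⧸ H) p := by
  have : CompleteSpace E := FiniteDimensional.complete ℝ E
  have hle := riemannianEDist_le_logMetricEstimate (F := F) hinv hπ hV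
  refine ⟨hle, fun K hK _ _ ↦ ?_⟩
  obtain ⟨C, hC⟩ := exists_logMetricEstimate_le_mul_riemannianEDist (F := F) hHcompact hπ
    (hπ' 1) hV hK
  refine ⟨max 1 C, le_max_left _ _, fun p hp ↦ ⟨hle p, (hC p hp).trans ?_⟩⟩
  gcongr
  exact le_max_right _ _
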